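/- Consider selfish mining in Ethereum. Blocks are found one after the other, independently: each one by the attacker with probability $q$ and by an honest miner with probability $p=1-q$, where $0\le q<p$. The attacker follows Strategy 1. An attack cycle starts when all miners agree on one official blockchain, and the attacker always mines on the tip of his own, initially secret, fork. * When he finds a block he keeps it secret, except if his whole fork is already public and in competition with an honest branch of the same height; then he publishes the new block and wins, and the cycle ends. * When the honest miners find a block: if their branch becomes longer than his fork, he gives up and adopts it, and the cycle ends; if his fork is then ahead by exactly one block, he publishes all of it and wins, and the cycle ends; otherwise he makes public the part of his fork that has the same height as the honest branch, which creates a competition between two branches of the same height. During a competition, an honest miner who finds a block has mined it on the attacker's branch with probability $\gamma\in[0,1]$, and on the honest branch with probability $1-\gamma$, independently of everything else. An uncle is an orphan block (a block that never becomes official) whose parent is official. A nephew of an uncle is an official block that was created after the uncle, descends from the uncle's parent, and whose height exceeds that of the uncle by some $d$ with $1\le d\le n_1$ (the distance). Every nephew refers to all uncles that it can refer to (with no bound on their number). Let $U$ be the number of uncles created during a given attack cycle that are referred by a nephew in that cycle or in a later one. Then $U$ is integrable and $$\mathbb E[U]=q+\frac{q^3\gamma}{p-q}-\frac{p^3}{p-q}\Bigl(\frac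 qp\Bigr)^{n_1+1}\gamma-q^{n_1+1}(1-\gamma).$$ -/

import Mathlib

open MeasureTheory ProbabilityTheory

namespace SelfishMining

/-- Who mines the next block: the selfish miner; an honest miner who, if the public is split
between two branches of the same height, works on the attacker's branch (`follow`); or an honest
miner who then works on the branch of the other honest miners (`oppose`). -/
inductive Draw
  | selfish
  | follow
  | oppose
  deriving DecidableEq

instance : MeasurableSpace Draw := ⊤

/-- Successive blocks are found independently: by the attacker with probability `q`, by an honest
miner with probability `p`; a proportion `γ` of the honest miners follows the attacker's branch
during a competition. -/
structure IsMiningProcess {Ω : Type*} [MeasurableSpace Ω] (P : Measure Ω) (p q γ : ℝ)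
    (D : ℕ → Ω → Draw) : Prop where
  measurable : ∀ t, Measurable (D t)
  indep : iIndepFun D P
  selfish : ∀ t, P.real {ω | D t ω = Draw.selfish} = q
  follow : ∀ t, P.real {ω | D t ω = Draw.follow} = p * γ
  oppose : ∀ t, P.real {ω | D t ω = Draw.oppose} = p * (1 - γ)

/-- A block, with its parent and its date of creation. `genesis` is the last official block
before the attack starts. -/
inductive Block
  | genesis
  | mined (parent : Block) (time : ℕ)
  deriving DecidableEq

namespace Block

def parent : Block → Block
  | genesis => genesis
  | mined b _ => b

def height : Block → ℕ
  | genesis => 0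
  | mined b _ => b.height + 1

/-- The chain that ends at a block: the block itself and all its ancestors. -/
def chain : Block → Set Block
  | genesis => {genesis}
  | mined b t => insert (mined b t) b.chain

/-- The block of height `h` in the chain of a block of height at least `h`. -/
def atHeight : Block → ℕ → Block
  | genesis, _ => genesis
  | mined b t, h => if b.height + 1 ≤ h then mined b t else b.atHeight h

end Block

/-- `base` is the tip of the official blockchain at the start of the current attack cycle, `fork`
the tip of the attacker's (partly secret) branch, `pub` the last block published by the honest
miners (`base` if there is none yet in this cycle), `cycle` the number of completed cycles.
The attacker always makes public the part of `fork` up to the height of `pub`, so whenever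
`pub ≠ base` there is a competition between `pub` and the block of `fork` of the same height. -/
structure State where
  base : Block
  fork : Block
  pub : Block
  cycle : ℕ

namespace State

/-- The attack cycle ends and `b` becomes the tip of the official blockchain. -/
def restart (s : State) (b : Block) : State := ⟨b, b, b, s.cycle + 1⟩

/-- The block that is mined at time `t`. (If `pub = base`, there is no competition, and the block
of `fork` at the height of `pub` is `pub` itself.) -/
def mine (s : State) (t : ℕ) : Draw → Block
  | Draw.selfish => Block.mined s.fork t
  | Draw.follow => Block.mined (s.fork.atHeight s.pub.height) t
  | Draw.oppose => Block.mined s.pub t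

/-- The attacker has found the block `b` on top of his fork. If his whole fork was public and
in competition with an honest branch of the same height, then he publishes `b` and wins;
otherwise he keeps `b` secret. -/
def afterSelfish (s : State) (b : Block) : State :=
  if s.base.height < s.pub.height ∧ s.fork.height = s.pub.height then s.restart b
  else { s with fork := b }

/-- The honest miners have published the block `b`. If it is higher than the attacker's fork, then
the attacker gives up and adopts it. If the fork is ahead by exactly one block, then he publishes
the whole fork and wins. Otherwise he publishes his fork up to the height of `b`, which
creates a new competition. -/
def afterHonest (s : State) (b : Block) : State :=
  if s.fork.height < b.height then s.restart b
  else if s.fork.height = b.height + 1 then s.restart s.fork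
  else { s with pub := b }

def step (s : State) (t : ℕ) : Draw → State
  | Draw.selfish => s.afterSelfish (s.mine t Draw.selfish)
  | Draw.follow => s.afterHonest (s.mine t Draw.follow)
  | Draw.oppose => s.afterHonest (s.mine t Draw.oppose)

end State

/-- The state just before the `t`-th block is mined. -/
def state (d : ℕ → Draw) : ℕ → State
  | 0 => ⟨Block.genesis, Block.genesis, Block.genesis, 0⟩
  | t + 1 => (state d t).step t (d t)

/-- The block mined at time `t`. -/
def block (d : ℕ → Draw) (t : ℕ) : Block := (state d t).mine t (d t)

/-- The official blockchain: the blocks on which everybody agrees at the end of some cycle. -/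
def official (d : ℕ → Draw) : Set Block := {b | ∃ t, b ∈ (state d t).base.chain}

/-- An uncle is an orphan block whose parent is official. -/
def IsUncle (d : ℕ → Draw) (b : Block) : Prop := b ∉ official d ∧ b.parent ∈ official d

/-- The official block mined at time `j` is a nephew that can refer to the block mined at
time `i`: it is younger, it descends from the parent of that block, and it is at a
distance between `1` and `n₁` from that block. -/
def IsNephew (d : ℕ → Draw) (n₁ j i : ℕ) : Prop :=
  i < j ∧ block d j ∈ official d ∧ (block d i).parent ∈ (block d j).chain ∧
    (block d i).height < (block d j).height ∧ (block d j).height ≤ (block d i).height + n₁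

/-- The number of uncles created during the `k`-th attack cycle (`k = 0` is the first one) that are
referred by a nephew in that cycle or in a later one, when every nephew refers to all uncles
that it can refer to. (The set is finite: if that cycle never ends, no block created in it or
later is official, so that there is no nephew.) -/
noncomputable def referredUncles (n₁ k : ℕ) (d : ℕ → Draw) : ℕ :=
  Set.ncard {i | (state d i).cycle = k ∧ IsUncle d (block d i) ∧ ∃ j, IsNephew d n₁ j i}

end SelfishMining

/-! The combinatorics of blocks separates from the probability. Whether an honest block becomes a
referred uncle depends on the future, but once the attacker leads by two, his fork is bound to
become official (`fork_mem_official`). An honest block found then is an orphan. Its parent is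
official exactly when no honest block preceded it in the cycle or it was mined on the attacker's
branch. The lowest possible nephew, the first official block still to be mined, lies just above the
present fork. So the current state and draw decide (`referred_iff_rewarded`). With a fork of one
block, exactly one of the two competing blocks is orphaned. Hence, if all cycles end, U counts the
rewarded draws of the cycle (`referredUncles_eq`).

The mean of such an additive count comes from a potential. If `φ` solves the one-step equation
`IsValue`, the expected rewards before time N plus the expected value at time N equal `φ 0 0`
(`sum_integral_reward`). With reward 1 per block, the nonnegative potential `waitValue` shows that
cycles have finite mean length, because q < p. So they end almost surely, and time N lies in one of
the cycles up to k with probability tending to 0. For the bounded potential `uncleValue` the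
remainder thus vanishes, and `uncleValue_zero` gives the closed form. -/

namespace SelfishMining

/-! ### Chains and heights of blocks. -/

namespace Block

theorem self_mem_chain (b : Block) : b ∈ b.chain := by
  cases b <;> simp [chain]

theorem chain_subset {a b : Block} (h : a ∈ b.chain) : a.chain ⊆ b.chain := by
  induction b with
  | genesis =>
    simp only [chain, Set.mem_singleton_iff] at h
    rw [h]
  | mined b t ih =>
    rcases h with rfl | h
    · exact subset_rfl
    · exact (ih h).trans (Set.subset_insert _ _)

theorem mem_chain_mined (b : Block) (t : ℕ) : b ∈ (mined b t).chain :=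
  Set.mem_insert_of_mem _ b.self_mem_chain

theorem mem_chain_trans {a b c : Block} (hab : a ∈ b.chain) (hbc : b ∈ c.chain) : a ∈ c.chain :=
  chain_subset hbc hab

theorem height_le_of_mem_chain {a b : Block} (h : a ∈ b.chain) : a.height ≤ b.height := by
  induction b with
  | genesis =>
    simp only [chain, Set.mem_singleton_iff] at h
    rw [h]
  | mined b t ih =>
    rcases h with rfl | h
    · exact le_rfl
    · exact (ih h).trans (Nat.le_succ _)

theorem eq_of_mem_chain {a b : Block} (h : a ∈ b.chain) (hle : b.height ≤ a.height) : a = b := by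
  cases b with
  | genesis => simpa [chain] using h
  | mined b t =>
    rcases h with rfl | h
    · rfl
    · have := height_le_of_mem_chain h
      simp only [height] at hle
      omega

/-- The chain of a block is linearly ordered by height. -/
theorem mem_chain_of_height_le {a b c : Block} (ha : a ∈ c.chain) (hb : b ∈ c.chain)
    (hle : a.height ≤ b.height) : a ∈ b.chain := by
  induction c with
  | genesis =>
    simp only [chain, Set.mem_singleton_iff] at ha hb
    subst ha hb
    exact self_mem_chain _
  | mined c t ih =>
    rcases hb with rfl | hb
    · exact ha
    · rcases ha with rfl | ha
      · have := height_le_of_mem_chain hb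
        simp only [height] at hle
        omega
      · exact ih ha hb

theorem atHeight_mem_chain (b : Block) (h : ℕ) : b.atHeight h ∈ b.chain := by
  induction b with
  | genesis => simp [atHeight, chain]
  | mined b t ih =>
    unfold atHeight
    split_ifs
    · exact self_mem_chain _
    · exact Set.mem_insert_of_mem _ ih

theorem height_atHeight {b : Block} {h : ℕ} (hle : h ≤ b.height) : (b.atHeight h).height = h := by
  induction b with
  | genesis => simp only [height] at hle; simp only [atHeight, height]; omega
  | mined b t ih =>
    simp only [height] at hle
    unfold atHeight
    split_ifs
    · simp only [height]; omega
    · exact ih (by omega)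

theorem atHeight_eq_of_mem_chain {a b : Block} (h : a ∈ b.chain) : b.atHeight a.height = a := by
  have hh := height_atHeight (height_le_of_mem_chain h)
  exact eq_of_mem_chain (mem_chain_of_height_le (b.atHeight_mem_chain _) h hh.le) hh.ge

/-- All the blocks of the chain of `b` were mined before time `t`. -/
def CreatedBefore (b : Block) (t : ℕ) : Prop := ∀ c j, mined c j ∈ b.chain → j < t

theorem CreatedBefore.mono {b : Block} {t u : ℕ} (h : b.CreatedBefore t) (htu : t ≤ u) :
    b.CreatedBefore u := fun c j hc => (h c j hc).trans_le htu

theorem CreatedBefore.of_mem {a b : Block} {t : ℕ} (h : b.CreatedBefore t) (ha : a ∈ b.chain) :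
    a.CreatedBefore t := fun c j hc => h c j (mem_chain_trans hc ha)

theorem CreatedBefore.mined {b : Block} {t : ℕ} (h : b.CreatedBefore t) :
    (mined b t).CreatedBefore (t + 1) := by
  rintro c j (hc | hc)
  · cases hc; exact Nat.lt_succ_self _
  · exact (h c j hc).trans (Nat.lt_succ_self _)

theorem CreatedBefore.not_mem {b : Block} {t : ℕ} (h : b.CreatedBefore t) (c : Block) :
    Block.mined c t ∉ b.chain := fun hc => (h c t hc).false

end Block

/-! ### Invariants of the states under one step of the strategy. -/

namespace State

open Block

/-- The properties shared by all states that occur just before time `t`. -/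
structure Valid (s : State) (t : ℕ) : Prop where
  base_mem_fork : s.base ∈ s.fork.chain
  base_mem_pub : s.base ∈ s.pub.chain
  fork_before : s.fork.CreatedBefore t
  pub_before : s.pub.CreatedBefore t
  -- The ancestors of `pub` may lie on the fork after a `follow` draw; only `pub` itself is kept off
  -- it.
  pub_mem_fork : s.pub ∈ s.fork.chain → s.pub = s.base
  phase : (s.fork = s.base ∧ s.pub = s.base) ∨
    (s.fork.height = s.base.height + 1 ∧ s.pub = s.base) ∨
    (s.fork.height = s.base.height + 1 ∧ s.pub.height = s.base.height + 1) ∨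
    s.pub.height + 2 ≤ s.fork.height

namespace Valid

variable {s : State} {t : ℕ}

theorem base_le_pub (hs : s.Valid t) : s.base.height ≤ s.pub.height :=
  height_le_of_mem_chain hs.base_mem_pub

theorem pub_le_fork (hs : s.Valid t) : s.pub.height ≤ s.fork.height := by
  rcases hs.phase with ⟨h, h'⟩ | ⟨h, h'⟩ | ⟨h, h'⟩ | h
  · rw [h, h']
  · rw [h, h']; omega
  · omega
  · omega

theorem pub_eq_base (hs : s.Valid t) (h : s.pub.height = s.base.height) : s.pub = s.base :=
  (eq_of_mem_chain hs.base_mem_pub h.le).symm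

/-- Both parents that an honest miner may choose have the height of `pub`. -/
theorem height_mine (hs : s.Valid t) {x : Draw} (hx : x ≠ Draw.selfish) :
    (s.mine t x).height = s.pub.height + 1 := by
  cases x with
  | selfish => exact absurd rfl hx
  | follow => simp only [mine, height, height_atHeight hs.pub_le_fork]
  | oppose => rfl

theorem mine_of_pub_eq_base (hs : s.Valid t) (h : s.pub = s.base) {x : Draw}
    (hx : x ≠ Draw.selfish) : s.mine t x = mined s.base t := by
  cases x with
  | selfish => exact absurd rfl hx
  | follow => simp only [mine, h, atHeight_eq_of_mem_chain hs.base_mem_fork]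
  | oppose => simp only [mine, h]

theorem mine_before (hs : s.Valid t) (x : Draw) : (s.mine t x).CreatedBefore (t + 1) := by
  cases x with
  | selfish => exact hs.fork_before.mined
  | follow => exact (hs.fork_before.of_mem (atHeight_mem_chain _ _)).mined
  | oppose => exact hs.pub_before.mined

theorem base_mem_mine (hs : s.Valid t) (x : Draw) : s.base ∈ (s.mine t x).chain := by
  cases x with
  | selfish => exact Set.mem_insert_of_mem _ hs.base_mem_fork
  | follow =>
    refine Set.mem_insert_of_mem _ (mem_chain_of_height_le hs.base_mem_fork
      (atHeight_mem_chain _ _) ?_)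
    rw [height_atHeight hs.pub_le_fork]
    exact hs.base_le_pub
  | oppose => exact Set.mem_insert_of_mem _ hs.base_mem_pub

end Valid

theorem exists_mine_eq (s : State) (t : ℕ) (x : Draw) : ∃ c, s.mine t x = mined c t := by
  cases x <;> exact ⟨_, rfl⟩

theorem step_of_ne_selfish (s : State) (t : ℕ) {x : Draw} (hx : x ≠ Draw.selfish) :
    s.step t x = s.afterHonest (s.mine t x) := by
  cases x <;> first | exact absurd rfl hx | rfl

/-- The possible transitions: the attacker extends his secret fork, the honest miners create a
competition, the attacker publishes his fork, or the new block ends the cycle. -/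
theorem Valid.step_cases {s : State} {t : ℕ} (hs : s.Valid t) (x : Draw) :
    (x = Draw.selfish ∧ (s.pub.height < s.fork.height ∨ s.fork = s.base ∧ s.pub = s.base) ∧
      s.step t x = { s with fork := mined s.fork t }) ∨
    (x ≠ Draw.selfish ∧
      (s.fork.height = s.base.height + 1 ∧ s.pub = s.base ∨ s.pub.height + 3 ≤ s.fork.height) ∧
      s.step t x = { s with pub := s.mine t x }) ∨
    (x ≠ Draw.selfish ∧ s.fork.height = s.pub.height + 2 ∧ s.step t x = s.restart s.fork) ∨
    ((x ≠ Draw.selfish ∧ s.fork = s.base ∧ s.pub = s.base ∨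
        s.fork.height = s.base.height + 1 ∧ s.pub.height = s.base.height + 1) ∧
      s.step t x = s.restart (s.mine t x)) := by
  by_cases hx : x = Draw.selfish
  · subst hx
    simp only [State.step, afterSelfish, mine]
    rcases hs.phase with ⟨h, h'⟩ | ⟨h, h'⟩ | ⟨h, h'⟩ | h
    · left; simp [h, h']
    · left; simp [h, h']
    · right; right; right; simp [h, h']
    · left; refine ⟨trivial, Or.inl (by omega), if_neg (by omega)⟩
  · rw [step_of_ne_selfish s t hx, afterHonest, hs.height_mine hx]
    rcases hs.phase with ⟨h, h'⟩ | ⟨h, h'⟩ | ⟨h, h'⟩ | h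
    · right; right; right; simp [h, h', hx]
    · right; left; simp [h, h', hx]
    · right; right; right; simp [h, h']
    · by_cases h2 : s.fork.height = s.pub.height + 2
      · right; right; left; simp [h2, hx]
      · right; left
        exact ⟨hx, Or.inr (by omega), by rw [if_neg (by omega), if_neg (by omega)]⟩

theorem valid_restart (s : State) {b : Block} {t : ℕ} (hb : b.CreatedBefore t) :
    (s.restart b).Valid t :=
  ⟨self_mem_chain _, self_mem_chain _, hb, hb, fun _ => rfl, Or.inl ⟨rfl, rfl⟩⟩

theorem Valid.step {s : State} {t : ℕ} (hs : s.Valid t) (x : Draw) :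
    (s.step t x).Valid (t + 1) := by
  rcases hs.step_cases x with ⟨rfl, h, e⟩ | ⟨hx, h, e⟩ | ⟨hx, h, e⟩ | ⟨h, e⟩ <;> rw [e]
  · refine ⟨Set.mem_insert_of_mem _ hs.base_mem_fork, hs.base_mem_pub, hs.fork_before.mined,
      hs.pub_before.mono t.le_succ, ?_, ?_⟩
    · rintro (hp | hp)
      · exact absurd (hp ▸ self_mem_chain _) (hs.pub_before.not_mem s.fork)
      · exact hs.pub_mem_fork hp
    · simp only [height]
      rcases h with h | ⟨h, h'⟩
      · right; right; right; omega
      · right; left; simp [h, h']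
  · refine ⟨hs.base_mem_fork, hs.base_mem_mine x, hs.fork_before.mono t.le_succ,
      hs.mine_before x, ?_, ?_⟩
    · intro hp
      obtain ⟨c, hc⟩ := s.exists_mine_eq t x
      simp only [hc] at hp
      exact absurd hp (hs.fork_before.not_mem c)
    · simp only [hs.height_mine hx]
      rcases h with ⟨h, h'⟩ | h
      · right; right; left; simp [h, h']
      · right; right; right; omega
  · exact valid_restart s (hs.fork_before.mono t.le_succ)
  · exact valid_restart s (hs.mine_before x)

/-- A cycle that ends makes the official blockchain longer. -/
theorem Valid.step_base {s : State} {t : ℕ} (hs : s.Valid t) (x : Draw) :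
    ((s.step t x).cycle = s.cycle ∧ (s.step t x).base = s.base) ∨
    ∃ b, s.step t x = s.restart b ∧ s.base ∈ b.chain ∧ s.base.height < b.height := by
  have h1 := hs.base_le_pub
  have h2 := hs.pub_le_fork
  rcases hs.step_cases x with ⟨rfl, h, e⟩ | ⟨hx, h, e⟩ | ⟨hx, h, e⟩ | ⟨h, e⟩
  · left; rw [e]; exact ⟨rfl, rfl⟩
  · left; rw [e]; exact ⟨rfl, rfl⟩
  · exact Or.inr ⟨_, e, hs.base_mem_fork, by omega⟩
  · refine Or.inr ⟨_, e, hs.base_mem_mine x, ?_⟩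
    by_cases hx : x = Draw.selfish
    · subst hx
      simp only [mine, height]
      omega
    · rw [hs.height_mine hx]
      omega

/-- A property of blocks is preserved by a step if it holds for the new block. -/
theorem forall_chain_step {s : State} {t : ℕ} (hs : s.Valid t) (x : Draw) {Q : Block → Prop}
    (hf : ∀ b ∈ s.fork.chain, Q b) (hp : ∀ b ∈ s.pub.chain, Q b) (hm : Q (s.mine t x)) :
    (∀ b ∈ (s.step t x).fork.chain, Q b) ∧ ∀ b ∈ (s.step t x).pub.chain, Q b := by
  have hmine : ∀ b ∈ (s.mine t x).chain, Q b := by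
    cases x with
    | selfish => rintro b (rfl | hb); exacts [hm, hf b hb]
    | follow =>
      rintro b (rfl | hb)
      exacts [hm, hf b (mem_chain_trans hb (atHeight_mem_chain _ _))]
    | oppose => rintro b (rfl | hb); exacts [hm, hp b hb]
  rcases hs.step_cases x with ⟨rfl, h, e⟩ | ⟨hx, h, e⟩ | ⟨hx, h, e⟩ | ⟨h, e⟩ <;> rw [e]
  · exact ⟨hmine, hp⟩
  · exact ⟨hf, hmine⟩
  · exact ⟨hf, hf⟩
  · exact ⟨hmine, hmine⟩

end State

/-! ### Monotonicity and block creation along a whole run. -/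

open Block

variable (d : ℕ → Draw)

theorem state_succ (t : ℕ) : state d (t + 1) = (state d t).step t (d t) := rfl

theorem valid_state (t : ℕ) : (state d t).Valid t := by
  induction t with
  | zero =>
    have h : Block.genesis.CreatedBefore 0 := by
      intro c j hc
      simp [chain] at hc
    exact ⟨self_mem_chain _, self_mem_chain _, h, h, fun _ => rfl, Or.inl ⟨rfl, rfl⟩⟩
  | succ t ih => exact ih.step _

theorem exists_block_eq (t : ℕ) : ∃ c, block d t = mined c t :=
  (state d t).exists_mine_eq t (d t)

theorem height_block (t : ℕ) : (block d t).height = (block d t).parent.height + 1 := by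
  obtain ⟨c, hc⟩ := exists_block_eq d t
  rw [hc]; rfl

theorem cycle_le_succ (t : ℕ) : (state d t).cycle ≤ (state d (t + 1)).cycle := by
  rcases (valid_state d t).step_base (d t) with ⟨h, -⟩ | ⟨b, h, -⟩
  · exact h.ge
  · rw [state_succ, h]; exact Nat.le_succ _

theorem cycle_mono : Monotone fun t => (state d t).cycle := monotone_nat_of_le_succ (cycle_le_succ d)

theorem base_mem_base {t u : ℕ} (h : t ≤ u) : (state d t).base ∈ (state d u).base.chain := by
  induction u, h using Nat.le_induction with
  | base => exact self_mem_chain _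
  | succ u _ ih =>
    rcases (valid_state d u).step_base (d u) with ⟨-, h⟩ | ⟨b, h, hb, -⟩
    · rw [state_succ, h]; exact ih
    · rw [state_succ, h]; exact mem_chain_trans ih hb

theorem cycle_le_height_base (t : ℕ) : (state d t).cycle ≤ (state d t).base.height := by
  induction t with
  | zero => exact le_rfl
  | succ t ih =>
    rcases (valid_state d t).step_base (d t) with ⟨h, h'⟩ | ⟨b, h, -, hb⟩
    · rw [state_succ, h, h']; exact ih
    · rw [state_succ, h]; simp only [State.restart]; omega

/-- The time stamp identifies a block, so a block found in some chain can be turned into an index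
`j` as required by `IsNephew`. -/
theorem mined_eq_block (t : ℕ) :
    (∀ b ∈ (state d t).fork.chain, ∀ c j, b = mined c j → b = block d j) ∧
      ∀ b ∈ (state d t).pub.chain, ∀ c j, b = mined c j → b = block d j := by
  induction t with
  | zero => constructor <;> (intro b hb c j h; subst h; simp [state, chain] at hb)
  | succ t ih =>
    refine State.forall_chain_step (valid_state d t) (d t) ih.1 ih.2 ?_
    intro c j h
    obtain ⟨c', hc'⟩ := exists_block_eq d t
    rw [block, h] at hc'
    cases hc'
    rfl

/-- The height of the fork never decreases, not even at a restart, and no new block exceeds the fork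
that results. Hence an official block above the present fork is still to be mined. -/
theorem height_block_le {t j : ℕ} (hj : j < t) :
    (block d j).height ≤ (state d t).fork.height := by
  induction t with
  | zero => omega
  | succ t ih =>
    have hs := valid_state d t
    have key : (state d t).fork.height ≤ (state d (t + 1)).fork.height ∧
        (block d t).height ≤ (state d (t + 1)).fork.height := by
      rw [state_succ, block]
      have h1 := hs.base_le_pub
      have h2 := hs.pub_le_fork
      rcases hs.step_cases (d t) with ⟨hx, h, e⟩ | ⟨hx, h, e⟩ | ⟨hx, h, e⟩ | ⟨h, e⟩ <;> rw [e]
      · rw [hx]; simp [State.mine, height]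
      · rw [hs.height_mine hx]
        refine ⟨le_rfl, ?_⟩
        rcases h with ⟨h, h'⟩ | h
        · simp [h, h']
        · simp only; omega
      · rw [hs.height_mine hx]
        exact ⟨le_rfl, by simp only [State.restart]; omega⟩
      · refine ⟨?_, le_rfl⟩
        by_cases hx : d t = Draw.selfish
        · simp [hx, State.restart, State.mine, height]
        · simp only [State.restart, hs.height_mine hx]
          rcases h with ⟨-, h, h'⟩ | h
          · simp [h, h']
          · omega
    rcases Nat.lt_succ_iff_lt_or_eq.1 hj with h | rfl
    · exact (ih h).trans key.1
    · exact key.2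

/-! ### The official blockchain -/

theorem base_mem_official (t : ℕ) : (state d t).base ∈ official d := ⟨t, self_mem_chain _⟩

variable {d}

theorem official_of_mem_chain {a b : Block} (hb : b ∈ official d) (ha : a ∈ b.chain) :
    a ∈ official d :=
  hb.imp fun _ h => mem_chain_trans ha h

theorem mem_chain_of_official {a b : Block} (ha : a ∈ official d) (hb : b ∈ official d)
    (hle : a.height ≤ b.height) : a ∈ b.chain := by
  obtain ⟨t, ht⟩ := ha
  obtain ⟨u, hu⟩ := hb
  exact mem_chain_of_height_le (mem_chain_trans ht (base_mem_base d (le_max_left t u)))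
    (mem_chain_trans hu (base_mem_base d (le_max_right t u))) hle

/-- Official blocks form one chain, so descent from an official parent is a matter of heights. -/
theorem exists_isNephew_iff {n i : ℕ} (hi : (block d i).parent ∈ official d) :
    (∃ j, IsNephew d n j i) ↔ ∃ j, i < j ∧ block d j ∈ official d ∧
      (block d i).height < (block d j).height ∧ (block d j).height ≤ (block d i).height + n := by
  refine exists_congr fun j => ⟨fun ⟨h1, h2, _, h3, h4⟩ => ⟨h1, h2, h3, h4⟩,
    fun ⟨h1, h2, h3, h4⟩ => ⟨h1, h2, ?_, h3, h4⟩⟩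
  refine mem_chain_of_official hi h2 ?_
  have := height_block d i
  omega

theorem not_isNephew_zero (j i : ℕ) : ¬ IsNephew d 0 j i := by
  rintro ⟨-, -, -, h, h'⟩
  omega

variable (hd : ∀ k, ∃ t, k < (state d t).cycle)
include hd

theorem exists_official_height (h : ℕ) : ∃ b ∈ official d, b.height = h := by
  obtain ⟨t, ht⟩ := hd h
  exact ⟨(state d t).base.atHeight h, ⟨t, atHeight_mem_chain _ _⟩,
    height_atHeight (ht.le.trans (cycle_le_height_base d t))⟩

/-- A fork that is ahead by two blocks becomes official. -/
theorem fork_mem_official {t : ℕ} (h : (state d t).pub.height + 2 ≤ (state d t).fork.height) :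
    (state d t).fork ∈ official d := by
  obtain ⟨u, hu⟩ := hd (state d t).cycle
  have htu : t ≤ u := by
    by_contra hlt
    exact absurd (cycle_mono d (not_le.1 hlt).le) (not_le.2 hu)
  obtain ⟨n, rfl⟩ := Nat.exists_eq_add_of_le htu
  clear htu
  induction n generalizing t with
  | zero => exact absurd hu (lt_irrefl _)
  | succ n ih =>
    have hs := valid_state d t
    have e' := state_succ d t
    have hu' : (state d t).cycle < (state d (t + 1 + n)).cycle := by
      rwa [add_right_comm, add_assoc]
    have h1 := hs.base_le_pub
    rcases hs.step_cases (d t) with ⟨hx, h', e⟩ | ⟨hx, h', e⟩ | ⟨hx, h', e⟩ | ⟨h', e⟩ <;>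
      rw [e] at e'
    · refine official_of_mem_chain (ih (t := t + 1) ?_ ?_) ?_
      · rw [e']; simp only [height]; omega
      · rw [e']; exact hu'
      · rw [e']; exact mem_chain_mined _ _
    · have hf : (state d (t + 1)).fork = (state d t).fork := by rw [e']
      rw [← hf]
      refine ih (t := t + 1) ?_ ?_
      · rw [e']; simp only [hs.height_mine hx]
        rcases h' with ⟨h', h''⟩ | h'
        · rw [h''] at h; omega
        · omega
      · rw [e']; exact hu'
    · have hf : (state d (t + 1)).base = (state d t).fork := by rw [e']; rfl
      rw [← hf]
      exact base_mem_official d _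
    · rcases h' with ⟨-, h', h''⟩ | h'
      · rw [h', h''] at h; omega
      · omega

omit hd in
/-- A fork that is official contains all official blocks up to its height. -/
theorem le_of_mem_official {t : ℕ} (hf : (state d t).fork ∈ official d) {j : ℕ} (hj : t ≤ j)
    (ho : block d j ∈ official d) : (state d t).fork.height < (block d j).height := by
  by_contra hle
  have hmem := mem_chain_of_official ho hf (not_lt.1 hle)
  obtain ⟨c, hc⟩ := exists_block_eq d j
  rw [hc] at hmem
  exact absurd ((valid_state d t).fork_before c j hmem) (by omega)

/-- The draw `x` in state `s` creates an uncle which a nephew at distance at most `n` can refer to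
(or one that replaces it, if the fork consists of one block only). -/
def Rewarded (n : ℕ) (s : State) (x : Draw) : Prop :=
  x ≠ Draw.selfish ∧ s.pub.height < s.fork.height ∧
    (s.pub.height = s.base.height ∨ x = Draw.follow) ∧ s.fork.height ≤ s.pub.height + n

/-- A block found while ahead makes the lead at least two, which already settles its fate. -/
theorem selfish_mem_official {i : ℕ} (hx : d i = Draw.selfish)
    (h : (state d i).pub.height < (state d i).fork.height) : block d i ∈ official d := by
  have hs := valid_state d i
  have e := state_succ d i
  have hf : (state d (i + 1)).fork = block d i ∧ (state d (i + 1)).pub = (state d i).pub := by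
    rcases hs.step_cases (d i) with ⟨_, h', e'⟩ | ⟨hx', _⟩ | ⟨hx', _⟩ | ⟨h', e'⟩
    · rw [e, e', block, hx]; exact ⟨rfl, rfl⟩
    · exact absurd hx hx'
    · exact absurd hx hx'
    · rcases h' with ⟨hx', _⟩ | h'
      · exact absurd hx hx'
      · omega
  rw [← hf.1]
  refine fork_mem_official hd ?_
  rw [hf.1, hf.2, block, hx]
  simp only [State.mine, height]
  omega

/-- The future is irrelevant here: the whole fork will be official, and every official block mined
from now on is higher than it. The distance test therefore concerns only the height just above the
fork. -/
theorem referred_iff_rewarded {n i : ℕ}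
    (h : (state d i).pub.height + 2 ≤ (state d i).fork.height) :
    (IsUncle d (block d i) ∧ ∃ j, IsNephew d n j i) ↔ Rewarded n (state d i) (d i) := by
  have hs := valid_state d i
  have hfo := fork_mem_official hd h
  by_cases hx : d i = Draw.selfish
  · refine ⟨fun h' => absurd (selfish_mem_official hd hx (by omega)) h'.1.1, fun h' =>
      absurd hx h'.1⟩
  have hh : (block d i).height = (state d i).pub.height + 1 := hs.height_mine hx
  have hno : block d i ∉ official d := fun ho => by
    have := le_of_mem_official hfo le_rfl ho
    omega
  -- Official blocks up to the height of the fork lie on the fork, and `pub` does not, unless it is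
  -- the base.
  have hpar : (block d i).parent ∈ official d ↔
      ((state d i).pub.height = (state d i).base.height ∨ d i = Draw.follow) := by
    constructor
    · intro hp
      by_contra hcon
      push Not at hcon
      have hb : block d i = mined (state d i).pub i := by
        rw [block]
        cases hdi : d i with
        | selfish => exact absurd hdi hx
        | follow => exact absurd hdi hcon.2
        | oppose => rfl
      rw [hb] at hp
      have := hs.pub_mem_fork (mem_chain_of_official hp hfo hs.pub_le_fork)
      exact hcon.1 (by rw [this])
    · rintro (hp | hp)
      · rw [block, hs.mine_of_pub_eq_base (hs.pub_eq_base hp) hx]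
        exact base_mem_official d i
      · rw [block, hp]
        exact official_of_mem_chain hfo (atHeight_mem_chain _ _)
  constructor
  · rintro ⟨⟨-, hp⟩, hj⟩
    obtain ⟨j, hij, ho, -, hle⟩ := (exists_isNephew_iff hp).1 hj
    have := le_of_mem_official hfo hij.le ho
    exact ⟨hx, by omega, hpar.1 hp, by omega⟩
  · rintro ⟨-, -, hp, hle⟩
    have hp := hpar.2 hp
    refine ⟨⟨hno, hp⟩, (exists_isNephew_iff hp).2 ?_⟩
    -- The nephew is the official block just above the fork: its height forces it to be younger than
    -- block `i`.
    obtain ⟨b, ⟨t, hb⟩, hbh⟩ := exists_official_height hd ((state d i).fork.height + 1)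
    cases b with
    | genesis => simp [height] at hbh
    | mined c j =>
      have hbj := (mined_eq_block d t).1 _ (mem_chain_trans hb (valid_state d t).base_mem_fork)
        c j rfl
      rw [hbj] at hb hbh
      have hij : i < j := by
        by_contra hji
        rcases (not_lt.1 hji).lt_or_eq with hji | rfl
        · have := height_block_le d hji; omega
        · omega
      exact ⟨j, hij, ⟨t, hb⟩, by omega, by omega⟩

end SelfishMining

/-! ### Counting the referred uncles of a cycle path by path. -/

namespace SelfishMining

open Block

/-- Every cycle starts with all miners agreeing on the official blockchain. -/
theorem exists_cycle_start {d : ℕ → Draw} {k : ℕ} (hk : ∃ t, k < (state d t).cycle) :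
    ∃ s, (state d s).cycle = k ∧ (state d s).fork = (state d s).base ∧
      (state d s).pub = (state d s).base ∧ ∀ t, (state d t).cycle = k → s ≤ t := by
  classical
  have hex : ∃ t, k ≤ (state d t).cycle := hk.imp fun _ h => h.le
  have hmin : ∀ t, (state d t).cycle = k → Nat.find hex ≤ t := fun t ht => Nat.find_min' hex ht.ge
  have hspec := Nat.find_spec hex
  rcases hs : Nat.find hex with _ | s
  · rw [hs] at hspec hmin
    have : k = 0 := by simpa [state] using hspec
    exact ⟨0, this.symm, rfl, rfl, hmin⟩
  · have hlt : (state d s).cycle < k := not_le.1 (Nat.find_min hex (by omega))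
    rw [hs] at hspec hmin
    rcases (valid_state d s).step_base (d s) with ⟨h, -⟩ | ⟨b, h, -⟩
    · rw [state_succ, h] at hspec; omega
    · refine ⟨s + 1, ?_, ?_, ?_, hmin⟩
      · rw [state_succ, h] at hspec ⊢
        simp only [State.restart] at hspec ⊢
        omega
      · rw [state_succ, h]; rfl
      · rw [state_succ, h]; rfl

/-- A lead of two shrinks further only by the attacker's publishing his fork, which ends the cycle.
-/
theorem lead_of_cycle_eq {d : ℕ → Draw} {s t : ℕ}
    (h : (state d s).pub.height + 2 ≤ (state d s).fork.height) (hst : s ≤ t)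
    (hc : (state d t).cycle = (state d s).cycle) :
    (state d t).pub.height + 2 ≤ (state d t).fork.height := by
  induction t, hst using Nat.le_induction with
  | base => exact h
  | succ t hst ih =>
    have hle : (state d s).cycle ≤ (state d t).cycle := cycle_mono d hst
    have hle' := cycle_le_succ d t
    have ih := ih (by omega)
    have hs := valid_state d t
    have e' := state_succ d t
    have h1 := hs.base_le_pub
    rcases hs.step_cases (d t) with ⟨hx, h', e⟩ | ⟨hx, h', e⟩ | ⟨hx, h', e⟩ | ⟨h', e⟩ <;>
      rw [e] at e'
    · rw [e']; simp only [height]; omega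
    · rw [e']; simp only [hs.height_mine hx]
      rcases h' with ⟨h', h''⟩ | h'
      · rw [h''] at ih; omega
      · omega
    · rw [e'] at hc; simp only [State.restart] at hc; omega
    · rw [e'] at hc; simp only [State.restart] at hc; omega

variable {d : ℕ → Draw} {s : ℕ}

/-- The state after the attacker's first block of a cycle. -/
theorem state_after_selfish (hf : (state d s).fork = (state d s).base)
    (hp : (state d s).pub = (state d s).base) (h0 : d s = Draw.selfish) :
    state d (s + 1) = ⟨(state d s).base, mined (state d s).base s, (state d s).base,
      (state d s).cycle⟩ := by
  rw [state_succ, h0]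
  simp only [State.step, State.afterSelfish, State.mine, hf, hp, lt_irrefl, false_and, if_false]

/-- A cycle in which the attacker finds the first block and the honest miners the second one. -/
theorem state_competition (hf : (state d s).fork = (state d s).base)
    (hp : (state d s).pub = (state d s).base) (h0 : d s = Draw.selfish)
    (h1 : d (s + 1) ≠ Draw.selfish) :
    state d (s + 2) = ⟨(state d s).base, mined (state d s).base s,
      mined (state d s).base (s + 1), (state d s).cycle⟩ ∧
      block d s = mined (state d s).base s ∧
      block d (s + 1) = mined (state d s).base (s + 1) ∧
      state d (s + 3) = (state d s).restart (block d (s + 2)) ∧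
      (block d (s + 2) = mined (mined (state d s).base s) (s + 2) ∨
        block d (s + 2) = mined (mined (state d s).base (s + 1)) (s + 2)) := by
  have e1 := state_after_selfish hf hp h0
  have hb1 : block d (s + 1) = mined (state d s).base (s + 1) := by
    have hs := valid_state d (s + 1)
    have h := hs.mine_of_pub_eq_base (by rw [e1]) h1
    rw [e1] at h
    rw [block, e1, h]
  have hb1' : (state d (s + 1)).mine (s + 1) (d (s + 1)) = mined (state d s).base (s + 1) := hb1
  have e2 : state d (s + 2) = ⟨(state d s).base, mined (state d s).base s,
      mined (state d s).base (s + 1), (state d s).cycle⟩ := by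
    rw [state_succ d (s + 1), State.step_of_ne_selfish _ _ h1, hb1', e1]
    simp [State.afterHonest, height]
  have e3 : state d (s + 3) = (state d s).restart (block d (s + 2)) := by
    rw [state_succ d (s + 2), block]
    have hs := valid_state d (s + 2)
    rcases hs.step_cases (d (s + 2)) with ⟨hx, h', e⟩ | ⟨hx, h', e⟩ | ⟨hx, h', e⟩ | ⟨h', e⟩
    · rw [e2] at h'
      rcases h' with h' | ⟨h', -⟩
      · simp [height] at h'
      · have := congrArg height h'
        simp [height] at this
    · rw [e2] at h'
      simp only [height] at h'
      rcases h' with ⟨-, h'⟩ | h'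
      · have := congrArg height h'
        simp [height] at this
      · omega
    · rw [e2] at h'; simp [height] at h'
    · rw [e, e2]; rfl
  refine ⟨e2, by rw [block, h0, State.mine, hf], hb1, e3, ?_⟩
  rw [block, e2]
  cases d (s + 2)
  · left; rfl
  · left; simp [State.mine, atHeight, height]
  · right; rfl

/-- The third block decides which of the two competing blocks is the uncle and is itself a nephew at
distance 1. The reward is always booked on the draw `s + 1`, though the uncle may be block `s`; so
only the cardinalities agree. -/
theorem referred_competition (n : ℕ) (hf : (state d s).fork = (state d s).base)
    (hp : (state d s).pub = (state d s).base) (h0 : d s = Draw.selfish)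
    (h1 : d (s + 1) ≠ Draw.selfish) (hmin : ∀ t, (state d t).cycle = (state d s).cycle → s ≤ t) :
    Set.ncard {i | (state d i).cycle = (state d s).cycle ∧ IsUncle d (block d i) ∧
        ∃ j, IsNephew d n j i} =
      Set.ncard {i | (state d i).cycle = (state d s).cycle ∧ Rewarded n (state d i) (d i)} := by
  have e1 := state_after_selfish hf hp h0
  obtain ⟨e2, hb0, hb1, e3, hb2⟩ := state_competition hf hp h0 h1
  have hrange : ∀ i, (state d i).cycle = (state d s).cycle → i = s ∨ i = s + 1 ∨ i = s + 2 := by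
    intro i hi
    have := hmin i hi
    by_contra hcon
    have h3 : (state d (s + 3)).cycle ≤ (state d i).cycle := cycle_mono d (by omega)
    rw [e3] at h3
    simp only [State.restart] at h3
    omega
  have ho2 : block d (s + 2) ∈ official d := by
    have := base_mem_official d (s + 3)
    rwa [e3] at this
  have hB := base_mem_official d s
  set B := (state d s).base with hBdef
  have hreward : {i | (state d i).cycle = (state d s).cycle ∧ Rewarded n (state d i) (d i)} =
      {i | i = s + 1 ∧ 1 ≤ n} := by
    ext i
    constructor
    · rintro ⟨hi, hr⟩
      rcases hrange i hi with rfl | rfl | rfl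
      · exact absurd h0 hr.1
      · have := hr.2.2.2
        rw [e1] at this
        simp only [height] at this
        exact ⟨rfl, by omega⟩
      · have := hr.2.1
        rw [e2] at this
        simp [height] at this
    · rintro ⟨rfl, hn⟩
      refine ⟨by rw [e1], h1, ?_⟩
      rw [e1]
      exact ⟨by simp [height], Or.inl rfl, by simpa [height] using hn⟩
  have hnot : ∀ {u v : ℕ}, u ≠ v → block d v = mined B v →
      block d (s + 2) = mined (mined B u) (s + 2) → v < s + 2 → block d v ∉ official d := by
    intro u v huv hv h2 hlt ho
    have hm := mem_chain_of_official ho ho2 (by rw [hv, h2]; simp [height])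
    rw [hv, h2] at hm
    rcases hm with h | h
    · cases h
    · have := eq_of_mem_chain h (by simp [height])
      cases this; exact huv rfl
  have hset : ∃ v, {i | (state d i).cycle = (state d s).cycle ∧ IsUncle d (block d i) ∧
      ∃ j, IsNephew d n j i} = {i | i = v ∧ 1 ≤ n} := by
    -- Symmetric in the two competitors: `u` is the winner, `v` the uncle.
    have key : ∀ u v, u ≠ v → (u = s ∨ u = s + 1) → (v = s ∨ v = s + 1) →
        block d u = mined B u → block d v = mined B v →
        block d (s + 2) = mined (mined B u) (s + 2) →
        {i | (state d i).cycle = (state d s).cycle ∧ IsUncle d (block d i) ∧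
          ∃ j, IsNephew d n j i} = {i | i = v ∧ 1 ≤ n} := by
      intro u v huv hu hv hbu hbv h2
      ext i
      constructor
      · rintro ⟨hi, hunc, j, hj⟩
        constructor
        · have hiu : i ≠ u := by
            rintro rfl
            refine hunc.1 (official_of_mem_chain ho2 ?_)
            rw [h2, hbu]
            exact mem_chain_mined _ _
          have hi2 : i ≠ s + 2 := by
            rintro rfl
            exact hunc.1 ho2
          have := hrange i hi
          omega
        · by_contra hn
          obtain rfl : n = 0 := by omega
          exact not_isNephew_zero _ _ hj
      · rintro ⟨rfl, hn⟩
        have hpar : (block d i).parent ∈ official d := by rw [hbv]; exact hB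
        refine ⟨?_, ⟨hnot huv hbv h2 (by omega), hpar⟩, ?_⟩
        · rcases hv with rfl | rfl
          · rfl
          · rw [e1]
        · refine (exists_isNephew_iff hpar).2 ⟨s + 2, by omega, ho2, ?_⟩
          rw [h2, hbv]
          simp only [height]
          omega
    rcases hb2 with h2 | h2
    · exact ⟨_, key s (s + 1) (by omega) (Or.inl rfl) (Or.inr rfl) hb0 hb1 h2⟩
    · exact ⟨_, key (s + 1) s (by omega) (Or.inr rfl) (Or.inl rfl) hb1 hb0 h2⟩
  obtain ⟨v, hv⟩ := hset
  rw [hv, hreward]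
  by_cases hn : 1 ≤ n <;> simp [hn]

/-- If all cycles end, then the referred uncles of a cycle can be counted by means of the states
and draws in that cycle. -/
theorem referredUncles_eq (hd : ∀ k, ∃ t, k < (state d t).cycle) (n k : ℕ) :
    referredUncles n k d = Set.ncard {i | (state d i).cycle = k ∧ Rewarded n (state d i) (d i)} := by
  obtain ⟨s, rfl, hf, hp, hmin⟩ := exists_cycle_start (hd k)
  rw [referredUncles]
  by_cases h0 : d s = Draw.selfish
  · have e1 := state_after_selfish hf hp h0
    by_cases h1 : d (s + 1) = Draw.selfish
    · have e2 : state d (s + 2) = ⟨(state d s).base, mined (mined (state d s).base s) (s + 1),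
          (state d s).base, (state d s).cycle⟩ := by
        rw [state_succ d (s + 1), h1, e1]
        simp [State.step, State.afterSelfish, State.mine]
      have hlead : (state d (s + 2)).pub.height + 2 ≤ (state d (s + 2)).fork.height := by
        rw [e2]; simp only [height]; omega
      have ho1 : block d (s + 1) ∈ official d :=
        selfish_mem_official hd h1 (by rw [e1]; simp [height])
      have ho0 : block d s ∈ official d := by
        refine official_of_mem_chain ho1 ?_
        rw [block, block, h0, h1, e1]
        simp only [State.mine, hf]
        exact mem_chain_mined _ _
      congr 1
      ext i
      refine and_congr_right fun hi => ?_
      have hsi := hmin i hi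
      by_cases hi0 : i = s
      · subst hi0
        exact ⟨fun h => absurd ho0 h.1.1, fun h => absurd h0 h.1⟩
      by_cases hi1 : i = s + 1
      · subst hi1
        exact ⟨fun h => absurd ho1 h.1.1, fun h => absurd h1 h.1⟩
      exact referred_iff_rewarded hd
        (lead_of_cycle_eq hlead (by omega) (by rw [hi, e2]))
    · exact referred_competition n hf hp h0 h1 hmin
  · congr 1
    ext i
    refine and_congr_right fun hi => ?_
    have hsi := hmin i hi
    -- An honest first block ends the cycle at once and is official.
    have e1 : state d (s + 1) = (state d s).restart (block d s) := by
      rcases (valid_state d s).step_cases (d s) with h | ⟨hx, h', e⟩ | ⟨hx, h', e⟩ | ⟨h', e⟩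
      · exact absurd h.1 h0
      · rw [hf, hp] at h'; omega
      · rw [hf, hp] at h'; omega
      · exact e
    obtain rfl : i = s := by
      by_contra hne
      have h3 : (state d (s + 1)).cycle ≤ (state d i).cycle := cycle_mono d (by omega)
      rw [e1] at h3
      simp only [State.restart] at h3
      omega
    refine ⟨fun h => absurd ?_ h.1.1, fun h => absurd h.2.1 (by rw [hf, hp]; omega)⟩
    have := base_mem_official d (i + 1)
    rwa [e1] at this

end SelfishMining

namespace SelfishMining

open Block

/-! ### Values of the states of a cycle -/

/-- The heights of the attacker's fork and of the honest branch over the base, in a cycle. -/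
def Reachable (a h : ℕ) : Prop :=
  (a = 0 ∧ h = 0) ∨ (a = 1 ∧ h = 0) ∨ (a = 1 ∧ h = 1) ∨ h + 2 ≤ a

/-- The value of a state, if the states of the `k`-th cycle have the value `φ`. -/
def cycleValue (k : ℕ) (φ : ℕ → ℕ → ℝ) (s : State) : ℝ :=
  if s.cycle < k then φ 0 0
  else if s.cycle = k then φ (s.fork.height - s.base.height) (s.pub.height - s.base.height)
  else 0

/-- The reward `ρ`, paid during the `k`-th cycle. -/
def cycleReward (k : ℕ) (ρ : ℕ → ℕ → Draw → ℝ) (s : State) (x : Draw) : ℝ :=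
  if s.cycle = k then ρ (s.fork.height - s.base.height) (s.pub.height - s.base.height) x else 0

/-- The expectation of `f` over the next draw. -/
def drawMean (p q γ : ℝ) (f : Draw → ℝ) : ℝ :=
  q * f Draw.selfish + p * γ * f Draw.follow + p * (1 - γ) * f Draw.oppose

/-- The value in the current cycle after the draw `x`. -/
def nextValue (φ : ℕ → ℕ → ℝ) (a h : ℕ) (x : Draw) : ℝ :=
  if x = Draw.selfish then (if a = 1 ∧ h = 1 then 0 else φ (a + 1) h)
  else if a = h ∨ a = h + 2 then 0 else φ a (h + 1)

/-- `φ` is the expected sum of the rewards `ρ` until the end of the cycle. -/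
def IsValue (p q γ : ℝ) (φ : ℕ → ℕ → ℝ) (ρ : ℕ → ℕ → Draw → ℝ) : Prop :=
  ∀ a h, Reachable a h → drawMean p q γ (fun x => ρ a h x + nextValue φ a h x) = φ a h

theorem State.Valid.reachable {s : State} {t : ℕ} (hs : s.Valid t) :
    Reachable (s.fork.height - s.base.height) (s.pub.height - s.base.height) := by
  have h1 := hs.base_le_pub
  rcases hs.phase with ⟨h, h'⟩ | ⟨h, h'⟩ | ⟨h, h'⟩ | h
  · left; rw [h, h']; omega
  · right; left; rw [h']; omega
  · right; right; left; omega
  · right; right; right; omega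

theorem cycleValue_restart (k : ℕ) (φ : ℕ → ℕ → ℝ) (s : State) (b : Block) :
    cycleValue k φ (s.restart b) = if s.cycle < k then φ 0 0 else 0 := by
  simp only [cycleValue, State.restart, Nat.sub_self]
  split_ifs <;> first | rfl | omega

theorem cycleValue_step_of_lt {k : ℕ} (φ : ℕ → ℕ → ℝ) {s : State} {t : ℕ} (hs : s.Valid t)
    (x : Draw) (h : s.cycle < k) : cycleValue k φ (s.step t x) = φ 0 0 := by
  rcases hs.step_base x with ⟨h', -⟩ | ⟨b, h', -⟩
  · rw [cycleValue, h', if_pos h]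
  · rw [h', cycleValue_restart, if_pos h]

theorem cycleValue_step_of_gt {k : ℕ} (φ : ℕ → ℕ → ℝ) {s : State} {t : ℕ} (hs : s.Valid t)
    (x : Draw) (h : k < s.cycle) : cycleValue k φ (s.step t x) = 0 := by
  rcases hs.step_base x with ⟨h', -⟩ | ⟨b, h', -⟩
  · rw [cycleValue, h', if_neg (by omega), if_neg (by omega)]
  · rw [h', cycleValue_restart, if_neg (by omega)]

theorem cycleValue_step_of_eq {k : ℕ} (φ : ℕ → ℕ → ℝ) {s : State} {t : ℕ} (hs : s.Valid t)
    (x : Draw) (h : s.cycle = k) : cycleValue k φ (s.step t x) =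
      nextValue φ (s.fork.height - s.base.height) (s.pub.height - s.base.height) x := by
  have h1 := hs.base_le_pub
  have h2 := hs.pub_le_fork
  rcases hs.step_cases x with ⟨hx, h', e⟩ | ⟨hx, h', e⟩ | ⟨hx, h', e⟩ | ⟨h', e⟩ <;> rw [e]
  · have hne : ¬ (s.fork.height - s.base.height = 1 ∧ s.pub.height - s.base.height = 1) := by
      rcases h' with h' | ⟨h', h''⟩
      · omega
      · rw [h', h'']; omega
    rw [cycleValue, nextValue, if_neg (by simp only; omega), if_pos h, if_pos hx, if_neg hne]
    simp only [height]
    congr 1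
    omega
  · have hh := hs.height_mine hx
    have hne : ¬ (s.fork.height - s.base.height = s.pub.height - s.base.height ∨
        s.fork.height - s.base.height = s.pub.height - s.base.height + 2) := by
      rcases h' with ⟨h', h''⟩ | h'
      · rw [h'']; omega
      · omega
    rw [cycleValue, nextValue, if_neg (by simp only; omega), if_pos h, if_neg hx, if_neg hne]
    simp only [hh]
    congr 1
    omega
  · rw [cycleValue_restart, if_neg (by omega), nextValue, if_neg hx, if_pos (by omega)]
  · rw [cycleValue_restart, if_neg (by omega), nextValue]
    rcases h' with ⟨hx, h', h''⟩ | h'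
    · rw [if_neg hx, if_pos (by rw [h', h'']; omega)]
    · rw [if_pos (show _ ∧ _ by omega), if_pos (show _ ∨ _ by omega), ite_self]

/-- Before cycle `k` the value is the constant `φ 0 0`, also at the step that opens the cycle;
afterwards it is 0. Only steps inside the cycle use the equation for `φ`. -/
theorem drawMean_reward_add_value {p q γ : ℝ} (hpq : p + q = 1) {φ : ℕ → ℕ → ℝ}
    {ρ : ℕ → ℕ → Draw → ℝ} (hφ : IsValue p q γ φ ρ) (k : ℕ) {s : State} {t : ℕ}
    (hs : s.Valid t) :
    drawMean p q γ (fun x => cycleReward k ρ s x + cycleValue k φ (s.step t x)) =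
      cycleValue k φ s := by
  rcases lt_trichotomy s.cycle k with h | h | h
  · simp only [cycleValue_step_of_lt φ hs _ h, cycleReward, if_neg h.ne, drawMean]
    rw [cycleValue, if_pos h]
    linear_combination φ 0 0 * hpq
  · simp only [cycleValue_step_of_eq φ hs _ h, cycleReward, if_pos h]
    rw [hφ _ _ hs.reachable, cycleValue, if_neg (by omega), if_pos h]
  · simp only [cycleValue_step_of_gt φ hs _ h, cycleReward, if_neg h.ne', drawMean]
    rw [cycleValue, if_neg (not_lt.2 h.le), if_neg h.ne']
    ring

/-! ### Expectations along the mining process -/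

instance : Finite Draw :=
  Finite.of_injective (β := Fin 3) (fun x => match x with | Draw.selfish => 0 | Draw.follow => 1 | Draw.oppose => 2)
    (by rintro (_ | _ | _) (_ | _ | _) h <;> simp_all)

instance : MeasurableSingletonClass Draw := ⟨fun _ => trivial⟩

theorem state_congr {d d' : ℕ → Draw} {t : ℕ} (h : ∀ i < t, d i = d' i) :
    state d t = state d' t := by
  induction t with
  | zero => rfl
  | succ t ih => rw [state_succ, state_succ, ih fun i hi => h i (by omega), h t (by omega)]

/-- The state at time `t` as a function of the earlier draws. -/
def stateOfPrefix (t : ℕ) (w : Finset.range t → Draw) : State :=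
  state (fun i => if h : i ∈ Finset.range t then w ⟨i, h⟩ else Draw.selfish) t

theorem stateOfPrefix_eq (d : ℕ → Draw) (t : ℕ) :
    stateOfPrefix t (fun i => d i) = state d t :=
  state_congr fun i hi => by simp [hi]

section Expectation

variable {Ω : Type*} [MeasurableSpace Ω] {P : Measure Ω} [IsProbabilityMeasure P]
  {p q γ : ℝ} {D : ℕ → Ω → Draw} (hD : IsMiningProcess P p q γ D)
include hD

omit [IsProbabilityMeasure P] in
theorem IsMiningProcess.measurable_prefix (S : Finset ℕ) :
    Measurable fun ω (i : S) => D i ω :=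
  measurable_pi_lambda _ fun i => hD.measurable i

/-- The state factors through finitely many draws, hence through a finite space; no σ-algebra on
`State` is needed. -/
theorem IsMiningProcess.integrable_state (t : ℕ) (F : State → ℝ) :
    Integrable (fun ω => F (state (fun i => D i ω) t)) P := by
  simp_rw [← stateOfPrefix_eq]
  exact Integrable.comp_measurable (f := fun ω (i : Finset.range t) => D i ω)
    (g := fun w => F (stateOfPrefix t w)) Integrable.of_finite
    (hD.measurable_prefix (Finset.range t))

theorem IsMiningProcess.integrable_state_draw (t : ℕ) (F : State → Draw → ℝ) :
    Integrable (fun ω => F (state (fun i => D i ω) t) (D t ω)) P := by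
  simp_rw [← stateOfPrefix_eq]
  exact Integrable.comp_measurable
    (f := fun ω => ((fun i => D i ω : Finset.range t → Draw), D t ω))
    (g := fun w => F (stateOfPrefix t w.1) w.2) Integrable.of_finite
    ((hD.measurable_prefix (Finset.range t)).prodMk (hD.measurable t))

-- The state at time `t` depends on earlier draws only, so it is independent of the draw at time
-- `t`.
omit [IsProbabilityMeasure P] in
theorem IsMiningProcess.integral_mul_indicator (t : ℕ) (F : State → ℝ) (x : Draw) :
    ∫ ω, F (state (fun i => D i ω) t) * (if D t ω = x then 1 else 0) ∂P =
      P.real {ω | D t ω = x} * ∫ ω, F (state (fun i => D i ω) t) ∂P := by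
  have hind := hD.indep.indepFun_finset (Finset.range t) {t} (by simp) hD.measurable
  have hcomp := hind.comp (φ := fun w => F (stateOfPrefix t w))
    (ψ := fun w => if w ⟨t, Finset.mem_singleton_self t⟩ = x then (1 : ℝ) else 0)
    (measurable_of_finite _) (measurable_of_finite _)
  have h := hcomp.integral_mul_eq_mul_integral
    ((measurable_of_finite _).comp (hD.measurable_prefix (Finset.range t))).aestronglyMeasurable
    ((measurable_of_finite _).comp (hD.measurable_prefix {t})).aestronglyMeasurable
  have hset : MeasurableSet {ω | D t ω = x} := hD.measurable t (measurableSet_singleton x)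
  have hprob : ∫ ω, (if D t ω = x then (1 : ℝ) else 0) ∂P = P.real {ω | D t ω = x} := by
    rw [← integral_indicator_one hset]
    simp only [Set.indicator_apply, Set.mem_ofPred_eq, Pi.one_apply]
  have hst : ∀ ω, stateOfPrefix t (fun i => D i ω) = state (fun i => D i ω) t :=
    fun ω => stateOfPrefix_eq (fun i => D i ω) t
  simp only [Function.comp_def, Pi.mul_apply, hst] at h
  rw [h, hprob, mul_comm]

theorem IsMiningProcess.integral_state_draw (t : ℕ) (F : State → Draw → ℝ) :
    ∫ ω, F (state (fun i => D i ω) t) (D t ω) ∂P =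
      ∫ ω, drawMean p q γ (F (state (fun i => D i ω) t)) ∂P := by
  have hsplit : ∀ ω, F (state (fun i => D i ω) t) (D t ω) =
      F (state (fun i => D i ω) t) Draw.selfish * (if D t ω = Draw.selfish then 1 else 0) +
      F (state (fun i => D i ω) t) Draw.follow * (if D t ω = Draw.follow then 1 else 0) +
      F (state (fun i => D i ω) t) Draw.oppose * (if D t ω = Draw.oppose then 1 else 0) := by
    intro ω
    cases D t ω <;> simp
  have hint : ∀ x, Integrable (fun ω => F (state (fun i => D i ω) t) x *
      (if D t ω = x then 1 else 0)) P := fun x =>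
    hD.integrable_state_draw t fun s y => F s x * (if y = x then 1 else 0)
  have hint' : ∀ (c : ℝ) x, Integrable (fun ω => c * F (state (fun i => D i ω) t) x) P :=
    fun c x => hD.integrable_state t fun s => c * F s x
  simp_rw [hsplit, drawMean]
  have hadd : ∀ {f g h : Ω → ℝ}, Integrable f P → Integrable g P → Integrable h P →
      ∫ ω, f ω + g ω + h ω ∂P = ∫ ω, f ω ∂P + ∫ ω, g ω ∂P + ∫ ω, h ω ∂P := by
    intro f g h hf hg hh
    rw [integral_add (f := fun ω => f ω + g ω) (hf.add hg) hh, integral_add hf hg]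
  rw [hadd (hint _) (hint _) (hint _), hadd (hint' _ _) (hint' _ _) (hint' _ _)]
  simp_rw [integral_const_mul, ← hD.selfish t, ← hD.follow t, ← hD.oppose t]
  rw [hD.integral_mul_indicator t (fun s => F s Draw.selfish),
    hD.integral_mul_indicator t (fun s => F s Draw.follow),
    hD.integral_mul_indicator t (fun s => F s Draw.oppose)]

/-- Rewards collected so far plus current value form a martingale; its mean is the initial value. -/
theorem IsMiningProcess.sum_integral_reward (hpq : p + q = 1) {φ : ℕ → ℕ → ℝ}
    {ρ : ℕ → ℕ → Draw → ℝ} (hφ : IsValue p q γ φ ρ) (k N : ℕ) :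
    ∑ t ∈ Finset.range N, ∫ ω, cycleReward k ρ (state (fun i => D i ω) t) (D t ω) ∂P +
      ∫ ω, cycleValue k φ (state (fun i => D i ω) N) ∂P = φ 0 0 := by
  induction N with
  | zero =>
    have : cycleValue k φ (state (fun _ => Draw.selfish) 0) = φ 0 0 := by
      simp only [cycleValue, state, Nat.sub_self]
      split_ifs <;> first | rfl | omega
    simpa [state] using this
  | succ N ih =>
    rw [Finset.sum_range_succ, add_assoc, ← ih]
    congr 1
    rw [← integral_add (hD.integrable_state_draw N fun s x => cycleReward k ρ s x)
      (hD.integrable_state (N + 1) _)]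
    simp_rw [state_succ]
    rw [hD.integral_state_draw N fun s x => cycleReward k ρ s x + cycleValue k φ (s.step N x)]
    refine integral_congr_ae (ae_of_all _ fun ω => ?_)
    exact drawMean_reward_add_value hpq hφ k (valid_state _ N)

end Expectation

end SelfishMining

namespace SelfishMining

/-! ### The length of a cycle -/

/-- The expected remaining length of a cycle. -/
noncomputable def waitValue (p q : ℝ) (a h : ℕ) : ℝ :=
  if a = 0 then 1 + q * (1 + p + q / (p - q))
  else if a = 1 then (if h = 0 then 1 + p + q / (p - q) else 1)
  else (a - h - 1) / (p - q)

/-- From a lead of at least two, the lead is a random walk with drift `-(p - q)` stopped at 1, which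
takes `(lead - 1) / (p - q)` steps on average. The other values follow by conditioning on the next
draw. -/
theorem isValue_waitValue {p q : ℝ} (γ : ℝ) (hpq : p + q = 1) (hqp : q < p) :
    IsValue p q γ (waitValue p q) (fun _ _ _ => 1) := by
  have hne : p - q ≠ 0 := (sub_pos.2 hqp).ne'
  obtain rfl : p = 1 - q := by linarith
  rintro a h (⟨rfl, rfl⟩ | ⟨rfl, rfl⟩ | ⟨rfl, rfl⟩ | hl)
  · simp [drawMean, nextValue, waitValue]; ring
  · simp [drawMean, nextValue, waitValue]; field_simp; ring
  · simp [drawMean, nextValue, waitValue]; linarith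
  · obtain ⟨m, rfl⟩ := Nat.exists_eq_add_of_le hl
    have h1 : ¬ (h + 2 + m = 1 ∧ h = 1) := by omega
    have h2 : h + 2 + m ≠ 0 := by omega
    have h3 : h + 2 + m ≠ 1 := by omega
    rcases m with _ | m
    · simp [drawMean, nextValue, waitValue]
      field_simp
      ring
    · have h4 : ¬ (h + 2 + (m + 1) = h ∨ h + 2 + (m + 1) = h + 2) := by omega
      simp only [drawMean, nextValue, waitValue, if_neg h1, if_neg h3, if_neg h4,
        reduceCtorEq, if_true, if_false, Nat.add_eq_zero_iff, one_ne_zero, and_false,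
        Nat.add_eq_right]
      push_cast
      field_simp
      ring

theorem waitValue_nonneg {p q : ℝ} (hq : 0 ≤ q) (hqp : q < p) {a h : ℕ} (hr : Reachable a h) :
    0 ≤ waitValue p q a h := by
  have hne : 0 < p - q := sub_pos.2 hqp
  have hp : 0 ≤ p := hq.trans hqp.le
  unfold waitValue
  split_ifs with h1 h2
  · positivity
  · positivity
  · positivity
  · have : h + 2 ≤ a := by rcases hr with h | h | h | h <;> omega
    have : (h : ℝ) + 2 ≤ a := by exact_mod_cast this
    exact div_nonneg (by linarith) hne.le

/-! ### The number of rewarded draws in a cycle -/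

/-- The decrease of the expected number of honest blocks at distance at most `n` when the lead
decreases from `m + 1` to `m`. -/
noncomputable def leadStep (p q γ : ℝ) (n m : ℕ) : ℝ := γ * ∑ j ∈ Finset.range (n - m), (q / p) ^ j

/-- The expected number of uncles at distance at most `n` that are created with the lead `l`
during a competition. -/
noncomputable def leadValue (p q γ : ℝ) (n l : ℕ) : ℝ :=
  ∑ m ∈ Finset.range (l - 1), leadStep p q γ n (m + 1)

/-- The same as `leadValue`, as long as there is no competition. -/
noncomputable def secretValue (p q γ : ℝ) (n l : ℕ) : ℝ :=
  leadValue p q γ n l + (1 - γ) * (1 - q ^ (n + 1 - l))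

/-- The expected number of uncles with reward in the rest of a cycle. -/
noncomputable def uncleValue (p q γ : ℝ) (n a h : ℕ) : ℝ :=
  if a = 0 then q * (p * (if 1 ≤ n then 1 else 0) + q * secretValue p q γ n 2)
  else if a = 1 then
    (if h = 0 then p * (if 1 ≤ n then 1 else 0) + q * secretValue p q γ n 2 else 0)
  else if h = 0 then secretValue p q γ n a else leadValue p q γ n (a - h)

open Classical in
/-- The reward of one for every rewarded draw. -/
noncomputable def uncleReward (n a h : ℕ) (x : Draw) : ℝ :=
  if x ≠ Draw.selfish ∧ h < a ∧ (h = 0 ∨ x = Draw.follow) ∧ a ≤ h + n then 1 else 0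

/-- This is the difference form of the recursion `leadValue_rec`. The solution chosen vanishes for
`m ≥ n`, which keeps `leadValue` bounded in the lead. -/
theorem leadStep_rec {p : ℝ} (q γ : ℝ) (hp : p ≠ 0) (n m : ℕ) :
    p * leadStep p q γ n m =
      p * (if m + 1 ≤ n then γ else 0) + q * leadStep p q γ n (m + 1) := by
  unfold leadStep
  split_ifs with h
  · rw [show n - m = n - (m + 1) + 1 by omega, Finset.sum_range_succ', pow_zero]
    simp_rw [pow_succ]
    rw [← Finset.sum_mul]
    field_simp
    ring
  · rw [show n - m = 0 by omega, show n - (m + 1) = 0 by omega]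
    simp

theorem leadValue_succ (p q γ : ℝ) (n l : ℕ) :
    leadValue p q γ n (l + 2) = leadValue p q γ n (l + 1) + leadStep p q γ n (l + 1) := by
  simp only [leadValue, show l + 2 - 1 = l + 1 by omega, show l + 1 - 1 = l by omega,
    Finset.sum_range_succ]

theorem leadValue_rec {p q : ℝ} (γ : ℝ) (hpq : p + q = 1) (hp : p ≠ 0) (n l : ℕ) :
    leadValue p q γ n (l + 2) = p * (if l + 2 ≤ n then γ else 0) +
      p * leadValue p q γ n (l + 1) + q * leadValue p q γ n (l + 3) := by
  rw [leadValue_succ p q γ n (l + 1), leadValue_succ]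
  linear_combination leadStep_rec q γ hp n (l + 1) -
    (leadValue p q γ n (l + 1) + leadStep p q γ n (l + 1)) * hpq

/-- For `l ≤ n`, the left side is the probability that an honest block comes before the attacker's
lead grows from `l` to `n + 1`; truncated subtraction makes it 0 for `l > n`. -/
theorem one_sub_pow_rec {p q : ℝ} (hpq : p + q = 1) (n l : ℕ) :
    1 - q ^ (n + 1 - l) = p * (if l ≤ n then 1 else 0) + q * (1 - q ^ (n + 1 - (l + 1))) := by
  split_ifs with h
  · rw [show n + 1 - l = n + 1 - (l + 1) + 1 by omega, pow_succ]
    linear_combination -hpq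
  · rw [show n + 1 - l = 0 by omega, show n + 1 - (l + 1) = 0 by omega]
    simp

theorem leadValue_one (p q γ : ℝ) (n : ℕ) : leadValue p q γ n 1 = 0 := by simp [leadValue]

/-- The first honest block of a cycle is rewarded whatever branch is favoured, later ones only with
probability `γ`. This is the term with `1 - γ` in `secretValue`. -/
theorem isValue_uncleValue {p q : ℝ} (γ : ℝ) (hpq : p + q = 1) (hp : p ≠ 0) (n : ℕ) :
    IsValue p q γ (uncleValue p q γ n) (uncleReward n) := by
  rintro a h (⟨rfl, rfl⟩ | ⟨rfl, rfl⟩ | ⟨rfl, rfl⟩ | hl)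
  · simp [drawMean, nextValue, uncleValue, uncleReward]
  · simp [drawMean, nextValue, uncleValue, uncleReward]
    split_ifs <;> ring
  · simp [drawMean, nextValue, uncleValue, uncleReward]
  · obtain ⟨l, rfl⟩ := Nat.exists_eq_add_of_le hl
    have h1 : ¬ (h + 2 + l = 1 ∧ h = 1) := by omega
    have h2 : h + 2 + l ≠ 0 := by omega
    have h3 : h + 2 + l ≠ 1 := by omega
    have h5 : h + 2 + l + 1 ≠ 0 := by omega
    have h6 : h + 2 + l + 1 ≠ 1 := by omega
    have hnext : ∀ x, x ≠ Draw.selfish → nextValue (uncleValue p q γ n) (h + 2 + l) h x =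
        leadValue p q γ n (l + 1) := by
      intro x hx
      rw [nextValue, if_neg hx]
      split_ifs with h4
      -- With a lead of two an honest block ends the cycle; the value 0 agrees with `leadValue` at
      -- lead 1.
      · obtain rfl : l = 0 := by omega
        rw [leadValue_one]
      · rw [uncleValue, if_neg h2, if_neg h3, if_neg (by omega)]
        congr 1
        omega
    have hself : nextValue (uncleValue p q γ n) (h + 2 + l) h Draw.selfish =
        if h = 0 then secretValue p q γ n (l + 3) else leadValue p q γ n (l + 3) := by
      rw [nextValue, if_pos rfl, if_neg h1, uncleValue, if_neg h5, if_neg h6]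
      split_ifs <;> congr 1 <;> omega
    have hcur : uncleValue p q γ n (h + 2 + l) h =
        if h = 0 then secretValue p q γ n (l + 2) else leadValue p q γ n (l + 2) := by
      rw [uncleValue, if_neg h2, if_neg h3]
      split_ifs <;> congr 1 <;> omega
    have hiff : (h + 2 + l ≤ h + n) ↔ l + 2 ≤ n := by omega
    have hlt : h < h + 2 + l := by omega
    have hrec := leadValue_rec γ hpq hp n l
    have hrec' := one_sub_pow_rec hpq n (l + 2)
    rw [drawMean, hself, hcur, hnext _ (by simp), hnext _ (by simp)]
    simp only [uncleReward, hiff, hlt, ne_eq, not_true, false_and, if_false, reduceCtorEq,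
      not_false_eq_true, true_and, or_true, or_false]
    by_cases h0 : h = 0
    · simp only [h0, if_true, true_and, secretValue]
      split_ifs at hrec hrec' ⊢
      · linear_combination -hrec - (1 - γ) * hrec'
      · linear_combination -hrec - (1 - γ) * hrec'
    · simp only [h0, if_false, false_and]
      split_ifs at hrec ⊢
      · linear_combination -hrec
      · linear_combination -hrec

theorem leadStep_nonneg {p q γ : ℝ} (hq : 0 ≤ q) (hp : 0 ≤ p) (hγ : 0 ≤ γ) (n m : ℕ) :
    0 ≤ leadStep p q γ n m := by
  unfold leadStep
  positivity

theorem abs_leadValue_le {p q γ : ℝ} (hq : 0 ≤ q) (hp : 0 ≤ p) (hγ : 0 ≤ γ) (n l : ℕ) :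
    |leadValue p q γ n l| ≤ ∑ m ∈ Finset.range n, leadStep p q γ n (m + 1) := by
  have hnn := leadStep_nonneg hq hp hγ n
  rw [leadValue, abs_of_nonneg (Finset.sum_nonneg fun _ _ => hnn _)]
  rw [← Finset.sum_filter_of_ne (p := fun m => m < n)]
  · refine Finset.sum_le_sum_of_subset_of_nonneg ?_ fun _ _ _ => hnn _
    intro m hm
    exact Finset.mem_range.2 (Finset.mem_filter.1 hm).2
  · intro m _ hm
    by_contra hlt
    refine hm ?_
    rw [leadStep, show n - (m + 1) = 0 by omega]
    simp

theorem exists_abs_uncleValue_le {p q γ : ℝ} (hpq : p + q = 1) (hq : 0 ≤ q) (hp : 0 ≤ p)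
    (hγ₀ : 0 ≤ γ) (hγ₁ : γ ≤ 1) (n : ℕ) : ∃ B, ∀ a h, |uncleValue p q γ n a h| ≤ B := by
  set G := ∑ m ∈ Finset.range n, leadStep p q γ n (m + 1)
  have hG : ∀ l, |leadValue p q γ n l| ≤ G := abs_leadValue_le hq hp hγ₀ n
  have hG0 : 0 ≤ G := (abs_nonneg _).trans (hG 0)
  have hF : ∀ l, |secretValue p q γ n l| ≤ G + 1 := by
    intro l
    have h1 : 0 ≤ q ^ (n + 1 - l) := by positivity
    have h2 : q ^ (n + 1 - l) ≤ 1 := pow_le_one₀ hq (by linarith)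
    refine (abs_add_le _ _).trans (add_le_add (hG l) ?_)
    rw [abs_of_nonneg (mul_nonneg (by linarith) (by linarith))]
    exact mul_le_one₀ (by linarith) (by linarith) (by linarith)
  refine ⟨|uncleValue p q γ n 0 0| + |uncleValue p q γ n 1 0| + (G + 1), fun a h => ?_⟩
  have h0 := abs_nonneg (uncleValue p q γ n 0 0)
  have h1 := abs_nonneg (uncleValue p q γ n 1 0)
  by_cases ha : a = 0
  · have : uncleValue p q γ n a h = uncleValue p q γ n 0 0 := by simp [uncleValue, ha]
    rw [this]; linarith
  by_cases ha1 : a = 1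
  · by_cases hh : h = 0
    · rw [ha1, hh]; linarith
    · have : uncleValue p q γ n a h = 0 := by simp [uncleValue, ha1, hh]
      rw [this, abs_zero]; linarith
  rw [uncleValue, if_neg ha, if_neg ha1]
  split_ifs
  · linarith [hF a]
  · linarith [hG (a - h)]

theorem uncleValue_zero {p q : ℝ} (γ : ℝ) (hpq : p + q = 1) (hq : 0 ≤ q) (hqp : q < p) (n : ℕ) :
    uncleValue p q γ n 0 0 = q + q ^ 3 * γ / (p - q) - p ^ 3 / (p - q) * (q / p) ^ (n + 1) * γ
        - q ^ (n + 1) * (1 - γ) := by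
  have hne : p - q ≠ 0 := (sub_pos.2 hqp).ne'
  have hp : p ≠ 0 := (hq.trans_lt hqp).ne'
  have hne1 : q / p ≠ 1 := by rw [Ne, div_eq_one_iff_eq hp]; exact hqp.ne
  -- For `n = 0` the exponent `n + 1 - 2` is truncated, so this case is separate.
  rcases n with _ | n
  · simp [uncleValue, secretValue, leadValue, leadStep]
    field_simp
    obtain rfl : p = 1 - q := by linarith
    ring
  · have hg : leadValue p q γ (n + 1) 2 = γ * (p * (1 - (q / p) ^ n) / (p - q)) := by
      simp only [leadValue, leadStep, Nat.add_one_sub_one, Finset.sum_range_one, zero_add]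
      rw [geom_sum_eq hne1]
      have : q / p - 1 = -((p - q) / p) := by field_simp; ring
      rw [this]
      field_simp
      ring
    simp only [uncleValue, secretValue, hg, if_true, le_add_iff_nonneg_left, zero_le,
      show n + 1 + 1 - 2 = n by omega]
    have hx : p ^ 3 * (q / p) ^ (n + 1 + 1) = p * q ^ 2 * (q / p) ^ n := by
      rw [pow_succ (q / p) (n + 1), pow_succ (q / p) n]; field_simp
    rw [div_mul_eq_mul_div, hx]
    generalize (q / p) ^ n = X
    rw [pow_succ q (n + 1), pow_succ q n]
    generalize q ^ n = Y
    field_simp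
    obtain rfl : p = 1 - q := by linarith
    ring

theorem cycleReward_uncleReward [∀ n s x, Decidable (Rewarded n s x)] {k n : ℕ} {s : State} {t : ℕ}
    (hs : s.Valid t) (x : Draw) : cycleReward k (uncleReward n) s x =
      if s.cycle = k ∧ Rewarded n s x then 1 else 0 := by
  have h1 := hs.base_le_pub
  have h2 := hs.pub_le_fork
  have hiff : (x ≠ Draw.selfish ∧ s.pub.height - s.base.height < s.fork.height - s.base.height ∧
      (s.pub.height - s.base.height = 0 ∨ x = Draw.follow) ∧
      s.fork.height - s.base.height ≤ s.pub.height - s.base.height + n) ↔ Rewarded n s x := by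
    rw [Rewarded, show s.pub.height - s.base.height < s.fork.height - s.base.height ↔
      s.pub.height < s.fork.height by omega, show s.pub.height - s.base.height = 0 ↔
      s.pub.height = s.base.height by omega, show s.fork.height - s.base.height ≤
      s.pub.height - s.base.height + n ↔ s.fork.height ≤ s.pub.height + n by omega]
  simp only [cycleReward, uncleReward, hiff]
  by_cases h : s.cycle = k <;> by_cases h' : Rewarded n s x <;> simp [h, h']

end SelfishMining

/-! ### Finiteness of cycles and passage to the limit. -/

namespace SelfishMining

open Filter Topology

section Expectation

variable {Ω : Type*} [MeasurableSpace Ω] {P : Measure Ω}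

/-- No measurability of `U` is assumed: it is inherited from the partial sums, and finiteness comes
from Tonelli's theorem. -/
theorem integrable_and_integral_eq_of_hasSum {R : ℕ → Ω → ℝ} (hR : ∀ t, Integrable (R t) P)
    (hnn : ∀ t ω, 0 ≤ R t ω) {U : Ω → ℝ} (hU : ∀ᵐ ω ∂P, HasSum (fun t => R t ω) (U ω)) {c : ℝ}
    (hc : HasSum (fun t => ∫ ω, R t ω ∂P) c) : Integrable U P ∧ ∫ ω, U ω ∂P = c := by
  have hU0 : 0 ≤ᵐ[P] U := hU.mono fun ω h => h.nonneg fun t => hnn t ω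
  refine ⟨⟨?_, ?_⟩, ?_⟩
  · refine aestronglyMeasurable_of_tendsto_ae atTop
      (f := fun N ω => ∑ t ∈ Finset.range N, R t ω) (fun N => ?_)
      (hU.mono fun ω h => h.tendsto_sum_nat)
    exact (integrable_finsetSum _ fun t _ => hR t).aestronglyMeasurable
  · rw [hasFiniteIntegral_iff_ofReal hU0]
    have h1 : (fun ω => ENNReal.ofReal (U ω)) =ᵐ[P] fun ω => ∑' t, ENNReal.ofReal (R t ω) := by
      filter_upwards [hU] with ω h
      rw [← h.tsum_eq, ENNReal.ofReal_tsum_of_nonneg (fun t => hnn t ω) h.summable]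
    rw [lintegral_congr_ae h1, lintegral_tsum fun t => (hR t).aemeasurable.ennreal_ofReal]
    simp_rw [← ofReal_integral_eq_lintegral_ofReal (hR _) (ae_of_all _ (hnn _))]
    rw [← ENNReal.ofReal_tsum_of_nonneg (fun t => integral_nonneg (hnn t)) hc.summable]
    exact ENNReal.ofReal_lt_top
  · have h2 := hasSum_integral_of_summable_integral_norm hR (by
      simpa only [Real.norm_of_nonneg (hnn _ _)] using hc.summable)
    rw [hc.unique h2]
    exact integral_congr_ae (hU.mono fun ω h => h.tsum_eq.symm)

variable [IsProbabilityMeasure P]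
  {p q γ : ℝ} {D : ℕ → Ω → Draw} (hD : IsMiningProcess P p q γ D)
include hD

/-- The series is the mean length of cycle `k`; dropping the nonnegative remainder bounds its
partial sums by `waitValue p q 0 0`. -/
theorem IsMiningProcess.summable_cycle (hpq : p + q = 1) (hq : 0 ≤ q) (hqp : q < p) (k : ℕ) :
    Summable fun t => ∫ ω, (if (state (fun i => D i ω) t).cycle = k then (1 : ℝ) else 0) ∂P := by
  have hnn : ∀ t ω, 0 ≤ if (state (fun i => D i ω) t).cycle = k then (1 : ℝ) else 0 := by
    intro t ω
    split_ifs <;> norm_num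
  refine summable_of_sum_range_le (c := waitValue p q 0 0) (fun t => integral_nonneg (hnn t))
    fun N => ?_
  have h := hD.sum_integral_reward hpq (isValue_waitValue γ hpq hqp) k N
  rw [← h]
  refine le_add_of_nonneg_right (integral_nonneg fun ω => ?_)
  simp only [cycleValue]
  split_ifs
  · exact waitValue_nonneg hq hqp (Or.inl ⟨rfl, rfl⟩)
  · exact waitValue_nonneg hq hqp (valid_state _ N).reachable
  · exact le_rfl

/-- Almost surely, every cycle is finite. -/
theorem IsMiningProcess.ae_finite_cycle (hpq : p + q = 1) (hq : 0 ≤ q) (hqp : q < p) :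
    ∀ᵐ ω ∂P, ∀ k, {t | (state (fun i => D i ω) t).cycle = k}.Finite := by
  rw [ae_all_iff]
  intro k
  -- Borel–Cantelli for the events that time `t` lies in cycle `k`.
  refine ae_finite_setOfPred_mem (s := fun t => {ω | (state (fun i => D i ω) t).cycle = k}) ?_
  have hnn : ∀ t ω, 0 ≤ if (state (fun i => D i ω) t).cycle = k then (1 : ℝ) else 0 := by
    intro t ω
    split_ifs <;> norm_num
  have hint : ∀ t, Integrable
      (fun ω => if (state (fun i => D i ω) t).cycle = k then (1 : ℝ) else 0) P := fun t =>
    hD.integrable_state t fun s => if s.cycle = k then 1 else 0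
  have hle : ∀ t, P {ω | (state (fun i => D i ω) t).cycle = k} ≤
      ENNReal.ofReal (∫ ω, (if (state (fun i => D i ω) t).cycle = k then (1 : ℝ) else 0) ∂P) := by
    intro t
    rw [ofReal_integral_eq_lintegral_ofReal (hint t) (ae_of_all _ (hnn t))]
    refine (measure_mono fun ω hω => ?_).trans
      ((one_mul _).symm.le.trans (mul_meas_ge_le_lintegral₀ (hint t).aemeasurable.ennreal_ofReal 1))
    simp_all
  refine ne_top_of_le_ne_top ?_ (ENNReal.tsum_le_tsum hle)
  rw [← ENNReal.ofReal_tsum_of_nonneg (fun t => integral_nonneg (hnn t))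
    (hD.summable_cycle hpq hq hqp k)]
  exact ENNReal.ofReal_ne_top

/-- The value is nonzero only in cycles up to `k`, and each of these is current at time `N` with a
probability that is a term of a convergent series. -/
theorem IsMiningProcess.tendsto_integral_cycleValue (hpq : p + q = 1) (hq : 0 ≤ q) (hqp : q < p)
    {φ : ℕ → ℕ → ℝ} {B : ℝ} (hB : ∀ a h, |φ a h| ≤ B) (k : ℕ) :
    Tendsto (fun N => ∫ ω, cycleValue k φ (state (fun i => D i ω) N) ∂P) atTop (𝓝 0) := by
  have hlim : Tendsto (fun N => B * ∑ j ∈ Finset.range (k + 1),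
      ∫ ω, (if (state (fun i => D i ω) N).cycle = j then (1 : ℝ) else 0) ∂P) atTop (𝓝 0) := by
    have h := tendsto_finsetSum (Finset.range (k + 1)) fun j _ =>
      (hD.summable_cycle hpq hq hqp j).tendsto_atTop_zero
    simpa using h.const_mul B
  refine squeeze_zero_norm (fun N => ?_) hlim
  have hint : ∀ j, Integrable
      (fun ω => if (state (fun i => D i ω) N).cycle = j then (1 : ℝ) else 0) P := fun j =>
    hD.integrable_state N fun s => if s.cycle = j then 1 else 0
  rw [← integral_finsetSum _ fun j _ => hint j, ← integral_const_mul]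
  refine norm_integral_le_of_norm_le ((integrable_finsetSum _ fun j _ => hint j).const_mul B)
    (ae_of_all _ fun ω => ?_)
  rw [Finset.sum_ite_eq, cycleValue, Real.norm_eq_abs]
  simp only [Finset.mem_range]
  split_ifs <;> first | omega | simp [hB]

end Expectation

end SelfishMining

theorem mainTheorem2 {Ω : Type*} [MeasurableSpace Ω] (P : Measure Ω) [IsProbabilityMeasure P]
    (p q γ : ℝ) (hpq : p + q = 1) (hq : 0 ≤ q) (hqp : q < p) (hγ₀ : 0 ≤ γ) (hγ₁ : γ ≤ 1)
    (D : ℕ → Ω → SelfishMining.Draw) (hD : SelfishMining.IsMiningProcess P p q γ D) (n₁ k : ℕ) :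
    Integrable (fun ω => (SelfishMining.referredUncles n₁ k (fun t => D t ω) : ℝ)) P ∧
    ∫ ω, (SelfishMining.referredUncles n₁ k (fun t => D t ω) : ℝ) ∂P =
      q + q ^ 3 * γ / (p - q) - p ^ 3 / (p - q) * (q / p) ^ (n₁ + 1) * γ
        - q ^ (n₁ + 1) * (1 - γ) := by
  open SelfishMining Filter Topology in
  classical
  have hp : 0 < p := hq.trans_lt hqp
  have hnn : ∀ t ω, 0 ≤ cycleReward k (uncleReward n₁) (state (fun i => D i ω) t) (D t ω) := by
    intro t ω
    simp only [cycleReward, uncleReward]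
    split_ifs <;> norm_num
  rw [← uncleValue_zero γ hpq hq hqp n₁]
  refine integrable_and_integral_eq_of_hasSum
    (fun t => hD.integrable_state_draw t (cycleReward k (uncleReward n₁))) hnn ?_ ?_
  · filter_upwards [hD.ae_finite_cycle hpq hq hqp] with ω hfin
    -- Otherwise ℕ would be a finite union of finite cycles.
    have hd : ∀ k, ∃ t, k < (state (fun i => D i ω) t).cycle := by
      intro k
      by_contra! hle
      refine Set.infinite_univ (α := ℕ) (((Set.finite_Iic k).biUnion fun j _ => hfin j).subset ?_)
      intro t _
      simpa using hle t
    have hS : {t | (state (fun i => D i ω) t).cycle = k ∧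
        Rewarded n₁ (state (fun i => D i ω) t) (D t ω)}.Finite :=
      (hfin k).subset fun t ht => ht.1
    rw [referredUncles_eq hd, Set.ncard_eq_toFinset_card _ hS]
    simp_rw [cycleReward_uncleReward (valid_state (fun i => D i ω) _)]
    have hsum := hasSum_sum_of_ne_finset_zero (s := hS.toFinset)
      (f := fun t => if (state (fun i => D i ω) t).cycle = k ∧
        Rewarded n₁ (state (fun i => D i ω) t) (D t ω) then (1 : ℝ) else 0)
      (L := SummationFilter.unconditional ℕ) (fun t ht => if_neg (by simpa using ht))
    convert hsum using 1
    rw [Finset.card_eq_sum_ones, Nat.cast_sum]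
    refine Finset.sum_congr rfl fun t ht => ?_
    rw [if_pos (by simpa using ht), Nat.cast_one]
  · rw [hasSum_iff_tendsto_nat_of_nonneg fun t => integral_nonneg (hnn t)]
    obtain ⟨B, hB⟩ := exists_abs_uncleValue_le hpq hq hp.le hγ₀ hγ₁ n₁
    have hlim := (hD.tendsto_integral_cycleValue hpq hq hqp hB k).const_sub
      (uncleValue p q γ n₁ 0 0)
    rw [sub_zero] at hlim
    refine hlim.congr fun N => ?_
    rw [← hD.sum_integral_reward hpq (isValue_uncleValue γ hpq hp.ne' n₁) k N, add_sub_cancel_right]
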